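/- Let $p$ be a prime and let $P$ be a finite non-abelian $p$-group. Let $\mathbb{Q}_n\subseteq\mathbb{C}$ denote the $n$-th cyclotomic field. Two irreducible complex characters $\chi,\psi$ of $P$ are called Galois conjugate if, for some positive multiple $n$ of $|P|$, there is $\sigma\in\mathrm{Gal}(\mathbb{Q}_n/\mathbb{Q})$ with $\sigma(\chi(g))=\psi(g)$ for all $g\in P$. Then the following are equivalent: (i) any two non-linear irreducible complex characters $\chi,\psi$ of $P$ (that is, with $\chi(1)\neq 1\neq\psi(1)$) with $\chi(1)=\psi(1)$ are Galois conjugate; (ii) the center $Z(P)$ is cyclic and the commutator subgroup $P'$ has order $p$. -/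

import Mathlib

/-- `χ : G → ℂ` is an irreducible complex character of `G`: the trace function of an irreducible
representation of `G` on some `ℂ ^ d`. -/
def IsIrrChar {G : Type*} [Group G] (χ : G → ℂ) : Prop :=
  ∃ (d : ℕ) (ρ : Representation ℂ G (Fin d → ℂ)), ρ.IsIrreducible ∧ χ = ρ.character

/-- The `n`-th cyclotomic field `ℚ_n`, as a subfield of `ℂ` (for `n ≠ 0`). -/
noncomputable def cyclotomicSubfield (n : ℕ) : IntermediateField ℚ ℂ :=
  IntermediateField.adjoin ℚ {z : ℂ | z ^ n = 1}

/-- `χ` and `ψ` take values in `ℚ_n`, and some `σ ∈ Gal(ℚ_n / ℚ)` carries `χ` to `ψ`. -/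
def GaloisConjugateIn {G : Type*} (n : ℕ) (χ ψ : G → ℂ) : Prop :=
  ∃ σ : cyclotomicSubfield n ≃ₐ[ℚ] cyclotomicSubfield n,
    ∀ g : G, ∃ x : cyclotomicSubfield n, (x : ℂ) = χ g ∧ (σ x : ℂ) = ψ g

/-- `χ` and `ψ` are Galois conjugate: conjugate under `Gal(ℚ_n / ℚ)` for some positive multiple
`n` of the order of the (finite) group `G`. -/
def GaloisConjugate {G : Type*} [Group G] (χ ψ : G → ℂ) : Prop :=
  ∃ n : ℕ, n ≠ 0 ∧ Nat.card G ∣ n ∧ GaloisConjugateIn n χ ψ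

/-- Any two non-linear irreducible characters of `G` of the same degree are Galois conjugate.
The degree of a character is its value at `1`. -/
def IsGCStarGroup (G : Type*) [Group G] : Prop :=
  ∀ χ ψ : G → ℂ, IsIrrChar χ → IsIrrChar ψ → χ 1 ≠ 1 → ψ 1 ≠ 1 → χ 1 = ψ 1 →
    GaloisConjugate χ ψ

open Module

section Irreducible

variable {G V : Type*} [Group G] [AddCommGroup V] [Module ℂ V]

theorem Representation.isIrreducible_iff_submodule {ρ : Representation ℂ G V} :
    ρ.IsIrreducible ↔ Nontrivial V ∧
      ∀ W : Submodule ℂ V, (∀ g, ∀ v ∈ W, ρ g v ∈ W) → W = ⊥ ∨ W = ⊤ := by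
  constructor
  · intro h
    refine ⟨?_, fun W hW => ?_⟩
    · by_contra hV
      rw [not_nontrivial_iff_subsingleton] at hV
      apply h.exists_pair_ne.elim
      rintro a ⟨b, hab⟩
      exact hab (Subrepresentation.toSubmodule_injective (Subsingleton.elim _ _))
    · rcases h.eq_bot_or_eq_top (⟨W, hW⟩ : Subrepresentation ρ) with h1 | h1
      · exact Or.inl (congrArg Subrepresentation.toSubmodule h1)
      · exact Or.inr (congrArg Subrepresentation.toSubmodule h1)
  · rintro ⟨hV, h⟩
    refine { exists_pair_ne := ⟨⊥, ⊤, fun hbt => ?_⟩, eq_bot_or_eq_top := fun W => ?_ }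
    · exact bot_ne_top (α := Submodule ℂ V) (congrArg Subrepresentation.toSubmodule hbt)
    · rcases h W.toSubmodule W.apply_mem_toSubmodule with h1 | h1
      · exact Or.inl (Subrepresentation.toSubmodule_injective h1)
      · exact Or.inr (Subrepresentation.toSubmodule_injective h1)

theorem Representation.IsIrreducible.nontrivial' {ρ : Representation ℂ G V}
    (h : ρ.IsIrreducible) : Nontrivial V :=
  (Representation.isIrreducible_iff_submodule.1 h).1

theorem Representation.IsIrreducible.eq_top {ρ : Representation ℂ G V} (h : ρ.IsIrreducible)
    {W : Submodule ℂ V} (hW : ∀ g, ∀ v ∈ W, ρ g v ∈ W) (hne : W ≠ ⊥) : W = ⊤ :=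
  ((Representation.isIrreducible_iff_submodule.1 h).2 W hW).resolve_left hne

/-- An irreducible representation is isomorphic to one on `Fin d → ℂ`. -/
theorem Representation.exists_fin_of_isIrreducible [FiniteDimensional ℂ V]
    (ρ : Representation ℂ G V) (h : ρ.IsIrreducible) :
    ∃ σ : Representation ℂ G (Fin (finrank ℂ V) → ℂ), σ.IsIrreducible ∧
      σ.character = ρ.character ∧ ∀ g, σ g = 1 ↔ ρ g = 1 := by
  let e : V ≃ₗ[ℂ] (Fin (finrank ℂ V) → ℂ) := LinearEquiv.ofFinrankEq _ _ (by simp)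
  let σ : Representation ℂ G (Fin (finrank ℂ V) → ℂ) :=
    { toFun := fun g => e.conj (ρ g)
      map_one' := by ext; simp
      map_mul' := fun a b => by ext; simp [LinearEquiv.conj_apply] }
  have hσ : ∀ g v, σ g v = e (ρ g (e.symm v)) := fun g v => rfl
  refine ⟨σ, ?_, ?_, fun g => ?_⟩
  · rw [Representation.isIrreducible_iff_submodule] at h ⊢
    obtain ⟨hV, h⟩ := h
    refine ⟨e.symm.toEquiv.nontrivial, fun W hW => ?_⟩
    rcases h (W.comap (e : V →ₗ[ℂ] _)) (fun g v hv => by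
      have := hW g (e v) hv
      rw [hσ] at this
      simpa using this) with h1 | h1
    · left
      rw [eq_bot_iff]
      intro w hw
      have : e.symm w ∈ W.comap (e : V →ₗ[ℂ] _) := by simpa using hw
      rw [h1] at this
      simpa using this
    · right
      rw [eq_top_iff]
      intro w _
      have : e.symm w ∈ W.comap (e : V →ₗ[ℂ] _) := by rw [h1]; trivial
      simpa using this
  · ext g
    exact LinearMap.trace_conj' (ρ g) e
  · constructor
    · intro h1
      ext v
      have := hσ g (e v)
      rw [h1] at this
      simpa using this.symm
    · intro h1
      refine LinearMap.ext fun v => ?_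
      rw [hσ, h1]
      simp

theorem isIrrChar_character [FiniteDimensional ℂ V] {ρ : Representation ℂ G V}
    (h : ρ.IsIrreducible) : IsIrrChar ρ.character := by
  obtain ⟨σ, h1, h2, -⟩ := ρ.exists_fin_of_isIrreducible h
  exact ⟨_, σ, h1, h2.symm⟩

theorem Representation.isIrreducible_comp {H : Type*} [Group H] {ρ : Representation ℂ G V}
    (h : ρ.IsIrreducible) {f : H →* G} (hf : Function.Surjective f) :
    Representation.IsIrreducible (ρ.comp f : Representation ℂ H V) := by
  rw [Representation.isIrreducible_iff_submodule] at h ⊢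
  refine ⟨h.1, fun W hW => h.2 W fun g v hv => ?_⟩
  obtain ⟨x, rfl⟩ := hf g
  exact hW x v hv

/-- The twist of a representation by a linear character. -/
noncomputable def Representation.twist (ρ : Representation ℂ G V) (μ : G →* ℂ) :
    Representation ℂ G V where
  toFun g := μ g • ρ g
  map_one' := by simp
  map_mul' a b := by rw [map_mul, map_mul, smul_mul_smul_comm]

theorem Representation.twist_apply (ρ : Representation ℂ G V) (μ : G →* ℂ) (g : G) :
    ρ.twist μ g = μ g • ρ g := rfl

theorem MonoidHom.apply_ne_zero (μ : G →* ℂ) (g : G) : μ g ≠ 0 :=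
  ((Group.isUnit g).map μ).ne_zero

theorem Representation.isIrreducible_twist {ρ : Representation ℂ G V} (h : ρ.IsIrreducible)
    (μ : G →* ℂ) : (ρ.twist μ).IsIrreducible := by
  rw [Representation.isIrreducible_iff_submodule] at h ⊢
  refine ⟨h.1, fun W hW => h.2 W fun g v hv => ?_⟩
  have := hW g v hv
  rw [Representation.twist_apply, LinearMap.smul_apply] at this
  exact (W.smul_mem_iff (μ.apply_ne_zero g)).1 this

/-- Schur's lemma. -/
theorem Representation.IsIrreducible.exists_eq_smul_one [FiniteDimensional ℂ V]
    {ρ : Representation ℂ G V} (h : ρ.IsIrreducible) (f : End ℂ V)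
    (hf : ∀ g, f * ρ g = ρ g * f) : ∃ c : ℂ, f = c • (1 : End ℂ V) := by
  have := h.nontrivial'
  obtain ⟨c, hc⟩ := Module.End.exists_eigenvalue f
  refine ⟨c, ?_⟩
  have key : Module.End.eigenspace f c = ⊤ := by
    refine h.eq_top (fun g v hv => ?_) hc
    rw [Module.End.mem_eigenspace_iff] at hv ⊢
    have h1 := LinearMap.congr_fun (hf g) v
    simp only [Module.End.mul_apply] at h1
    rw [h1, hv, map_smul]
  ext v
  have : v ∈ Module.End.eigenspace f c := by rw [key]; trivial
  simpa [Module.End.mem_eigenspace_iff] using this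

theorem Representation.IsIrreducible.finrank_eq_one_of_scalar [FiniteDimensional ℂ V]
    {ρ : Representation ℂ G V} (h : ρ.IsIrreducible) {v : V} (hv : v ≠ 0)
    (hs : ∀ g, ∃ c : ℂ, ρ g v = c • v) : finrank ℂ V = 1 := by
  have : ℂ ∙ v = ⊤ := by
    refine h.eq_top (fun g w hw => ?_) (by simpa using hv)
    obtain ⟨a, rfl⟩ := Submodule.mem_span_singleton.1 hw
    obtain ⟨c, hc⟩ := hs g
    rw [map_smul, hc]
    exact Submodule.smul_mem _ _ (Submodule.smul_mem _ _ (Submodule.mem_span_singleton_self v))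
  rw [← finrank_top, ← this, finrank_span_singleton hv]

theorem Representation.IsIrreducible.finrank_eq_one_of_commutator_le_ker [FiniteDimensional ℂ V]
    {ρ : Representation ℂ G V} (h : ρ.IsIrreducible) (hc : ∀ g ∈ commutator G, ρ g = 1) :
    finrank ℂ V = 1 := by
  have := h.nontrivial'
  obtain ⟨v, hv⟩ := exists_ne (0 : V)
  refine h.finrank_eq_one_of_scalar hv fun g => ?_
  obtain ⟨c, hc⟩ := h.exists_eq_smul_one (ρ g) fun x => by
    have h1 : ρ (g * x * g⁻¹ * x⁻¹) = 1 := hc _ (Subgroup.commutator_mem_commutator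
      (Subgroup.mem_top g) (Subgroup.mem_top x))
    rw [← map_mul, ← map_mul, show g * x = (g * x * g⁻¹ * x⁻¹) * (x * g) by group, map_mul, h1,
      one_mul]
  exact ⟨c, by rw [hc]; simp⟩

/-- A one-dimensional representation is given by a linear character. -/
theorem Representation.exists_linear_of_finrank_eq_one {ρ : Representation ℂ G V}
    (h : finrank ℂ V = 1) : ∃ μ : G →* ℂ, ∀ g, ρ g = μ g • (1 : End ℂ V) := by
  have hs : ∀ g, ∃ c : ℂ, ρ g = c • (1 : End ℂ V) := fun g => by
    obtain ⟨c, hc, -⟩ := LinearMap.existsUnique_eq_smul_id_of_finrank_eq_one h (ρ g)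
    exact ⟨c, hc⟩
  have : Nontrivial V := nontrivial_of_finrank_pos (R := ℂ) (by omega)
  choose c hc using hs
  have inj : Function.Injective fun c : ℂ => c • (1 : End ℂ V) := smul_left_injective ℂ one_ne_zero
  refine ⟨⟨⟨c, inj ?_⟩, fun a b => inj ?_⟩, hc⟩
  · simp only; rw [← hc, map_one, one_smul]
  · simp only; rw [← hc, map_mul, hc a, hc b, smul_mul_smul_comm, one_mul]

theorem Representation.apply_eq_one_of_mem_commutator {ρ : Representation ℂ G V}
    (h : finrank ℂ V = 1) {g : G} (hg : g ∈ commutator G) : ρ g = 1 := by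
  obtain ⟨μ, hμ⟩ := Representation.exists_linear_of_finrank_eq_one (ρ := ρ) h
  have h1 : g ∈ μ.ker := by
    refine (Subgroup.commutator_le.2 fun a _ b _ => ?_ : commutator G ≤ μ.ker) hg
    rw [MonoidHom.mem_ker, commutatorElement_def, map_mul, map_mul, map_mul, mul_comm (μ a),
      mul_assoc (μ b), ← map_mul μ a, mul_inv_cancel, map_one, mul_one, ← map_mul,
      mul_inv_cancel, map_one]
  rw [hμ, MonoidHom.mem_ker.1 h1, one_smul]

theorem Representation.IsIrreducible.exists_centralChar [FiniteDimensional ℂ V]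
    {ρ : Representation ℂ G V} (h : ρ.IsIrreducible) :
    ∃ μ : Subgroup.center G →* ℂ, ∀ z : Subgroup.center G, ρ z = μ z • (1 : End ℂ V) := by
  have := h.nontrivial'
  have hs : ∀ z : Subgroup.center G, ∃ c : ℂ, ρ z = c • (1 : End ℂ V) := fun z =>
    h.exists_eq_smul_one _ fun g => by
      rw [← map_mul, ← map_mul, Subgroup.mem_center_iff.1 z.2 g]
  choose c hc using hs
  have inj : Function.Injective fun c : ℂ => c • (1 : End ℂ V) := smul_left_injective ℂ one_ne_zero
  refine ⟨⟨⟨c, inj ?_⟩, fun a b => inj ?_⟩, hc⟩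
  · simp only; rw [← hc, Subgroup.coe_one, map_one, one_smul]
  · simp only; rw [← hc, Subgroup.coe_mul, map_mul, hc a, hc b, smul_mul_smul_comm, one_mul]

theorem Representation.character_of_eq_smul_one [FiniteDimensional ℂ V]
    {ρ : Representation ℂ G V} {g : G} {c : ℂ} (h : ρ g = c • (1 : End ℂ V)) :
    ρ.character g = c * finrank ℂ V := by
  rw [Representation.character, h, map_smul, LinearMap.trace_one, smul_eq_mul]

/-- For central elements, lying in the kernel can be read off the character. -/
theorem Representation.IsIrreducible.character_eq_iff [FiniteDimensional ℂ V]
    {ρ : Representation ℂ G V} (h : ρ.IsIrreducible) {z : G} (hz : z ∈ Subgroup.center G) :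
    ρ.character z = ρ.character 1 ↔ ρ z = 1 := by
  have := h.nontrivial'
  obtain ⟨μ, hμ⟩ := h.exists_centralChar
  have h0 : (finrank ℂ V : ℂ) ≠ 0 := by exact_mod_cast (finrank_pos (R := ℂ) (M := V)).ne'
  constructor
  · intro h1
    rw [Representation.character_of_eq_smul_one (hμ ⟨z, hz⟩), Representation.char_one] at h1
    rw [hμ ⟨z, hz⟩, mul_right_cancel₀ h0 (h1.trans (one_mul _).symm), one_smul]
  · intro h1
    rw [Representation.character, Representation.character, h1, map_one ρ]

theorem Representation.IsIrreducible.character_eq_zero [FiniteDimensional ℂ V]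
    {ρ : Representation ℂ G V} (h : ρ.IsIrreducible) {z g x : G} (hz : z ∈ Subgroup.center G)
    (hρ : ρ z ≠ 1) (hx : x * g * x⁻¹ = z * g) : ρ.character g = 0 := by
  obtain ⟨μ, hμ⟩ := h.exists_centralChar
  have h1 : ρ.character g = μ ⟨z, hz⟩ * ρ.character g := by
    conv_lhs => rw [← ρ.char_conj g x, hx, Representation.character, map_mul, hμ ⟨z, hz⟩]
    rw [smul_one_mul, map_smul, smul_eq_mul, Representation.character]
  by_contra h0
  apply hρ
  rw [hμ ⟨z, hz⟩, ← mul_right_cancel₀ h0 ((one_mul _).trans h1), one_smul]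

theorem Representation.IsIrreducible.finrank_sq_mul_card_center [Finite G]
    [FiniteDimensional ℂ V] {ρ : Representation ℂ G V} (h : ρ.IsIrreducible)
    (h0 : ∀ g, g ∉ Subgroup.center G → ρ.character g = 0) :
    finrank ℂ V ^ 2 * Nat.card (Subgroup.center G) = Nat.card G := by
  classical
  have := Fintype.ofFinite G
  have hG : (Nat.card G : ℂ) ≠ 0 := by exact_mod_cast Nat.card_pos.ne'
  have : Invertible (Nat.card G : ℂ) := invertibleOfNonzero hG
  have h1 := ρ.char_orthonormal ρ
  rw [if_pos ⟨Representation.Equiv.refl ρ⟩, inv_mul_eq_iff_eq_mul₀ hG, mul_one] at h1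
  obtain ⟨μ, hμ⟩ := h.exists_centralChar
  have h2 : ∀ g : G, ρ.character g * ρ.character g⁻¹ =
      if g ∈ Subgroup.center G then (finrank ℂ V : ℂ) ^ 2 else 0 := by
    intro g
    split_ifs with hg
    · rw [Representation.character_of_eq_smul_one (hμ ⟨g, hg⟩),
        Representation.character_of_eq_smul_one (g := g⁻¹) (hμ ⟨g, hg⟩⁻¹)]
      have : μ ⟨g, hg⟩ * μ ⟨g, hg⟩⁻¹ = 1 := by rw [← map_mul, mul_inv_cancel, map_one]
      linear_combination (finrank ℂ V : ℂ) ^ 2 * this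
    · rw [h0 g hg, zero_mul]
  simp_rw [h2] at h1
  rw [← Finset.sum_filter, Finset.sum_const, nsmul_eq_mul] at h1
  have h3 : (Finset.univ.filter (· ∈ Subgroup.center G)).card = Nat.card (Subgroup.center G) := by
    rw [Nat.card_eq_fintype_card, Fintype.card_subtype]
  rw [h3] at h1
  rw [mul_comm]
  exact_mod_cast h1

/-- Irreducible representations separate the elements of a finite group. -/
theorem exists_irreducible_apply_ne_one [Finite G] {g : G} (hg : g ≠ 1) :
    ∃ (d : ℕ) (ρ : Representation ℂ G (Fin d → ℂ)), ρ.IsIrreducible ∧ ρ g ≠ 1 := by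
  have := Fintype.ofFinite G
  have : NeZero (Nat.card G : ℂ) := ⟨by exact_mod_cast Nat.card_pos.ne'⟩
  let R := MonoidAlgebra ℂ G
  have hJ : Ring.jacobson R = ⊥ := IsSemisimpleRing.jacobson_eq_bot R
  have hx : MonoidAlgebra.of ℂ G g - 1 ≠ 0 := by
    rw [sub_ne_zero, ← map_one (MonoidAlgebra.of ℂ G)]
    exact fun h => hg (MonoidAlgebra.of_injective h)
  have hM : ∃ M : Submodule R R, IsCoatom M ∧ MonoidAlgebra.of ℂ G g - 1 ∉ M := by
    by_contra! hcon
    apply hx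
    rw [← Submodule.mem_bot R, ← hJ]
    exact (Submodule.mem_sInf).2 fun M hM => hcon M hM
  obtain ⟨M, hM, hgM⟩ := hM
  let ρ : Representation ℂ G (R ⧸ M) :=
    ((Algebra.lsmul ℂ ℂ (R ⧸ M) : R →ₐ[ℂ] _) : R →* _).comp (MonoidAlgebra.of ℂ G)
  have hρ : ∀ x v, ρ x v = MonoidAlgebra.of ℂ G x • v := fun x v => rfl
  have hsimple : IsSimpleModule R (R ⧸ M) := isSimpleModule_iff_isCoatom.2 hM
  have hirr : ρ.IsIrreducible := by
    refine Representation.isIrreducible_iff_submodule.2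
      ⟨IsSimpleModule.nontrivial R _, fun W hW => ?_⟩
    let W' : Submodule R (R ⧸ M) :=
      { W with
        smul_mem' := fun r v hv => by
          induction r using MonoidAlgebra.induction_on with
          | of x => exact hW x v hv
          | add a b ha hb => rw [add_smul]; exact W.add_mem ha hb
          | smul c a ha => rw [smul_assoc]; exact W.smul_mem c ha }
    have hW' : ∀ v, v ∈ W' ↔ v ∈ W := fun v => Iff.rfl
    rcases eq_bot_or_eq_top W' with h | h
    · left
      ext v
      rw [← hW', h, Submodule.mem_bot, Submodule.mem_bot]
    · right
      ext v
      rw [← hW', h]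
      simp
  have : FiniteDimensional ℂ R := inferInstanceAs (FiniteDimensional ℂ (MonoidAlgebra ℂ G))
  have : FiniteDimensional ℂ (R ⧸ M) :=
    Module.Finite.of_surjective (M.mkQ.restrictScalars ℂ) M.mkQ_surjective
  obtain ⟨σ, h1, -, h2⟩ := ρ.exists_fin_of_isIrreducible hirr
  refine ⟨_, σ, h1, fun h => hgM ?_⟩
  have h3 := hρ g (Submodule.Quotient.mk 1)
  rw [(h2 g).1 h, ← Submodule.Quotient.mk_smul, smul_eq_mul, mul_one] at h3
  exact (Submodule.Quotient.eq M).1 h3.symm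

end Irreducible

section PrimeSubgroups

variable {G : Type*} [Group G]

theorem Subgroup.le_of_mem_of_card_prime {p : ℕ} (hp : p.Prime) {H K : Subgroup G}
    (hH : Nat.card H = p) {z : G} (hzH : z ∈ H) (hzK : z ∈ K) (hz : z ≠ 1) : H ≤ K := by
  have : Fact p.Prime := ⟨hp⟩
  intro x hx
  have h1 : (⟨x, hx⟩ : H) ∈ Subgroup.zpowers (⟨z, hzH⟩ : H) :=
    mem_zpowers_of_prime_card hH fun h => hz (congrArg Subtype.val h)
  obtain ⟨k, hk⟩ := Subgroup.mem_zpowers_iff.1 h1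
  have h2 : z ^ k = x := congrArg Subtype.val hk
  exact h2 ▸ K.zpow_mem hzK k

theorem IsPGroup.exists_mem_inf_center {p : ℕ} [hp : Fact p.Prime] [Finite G]
    (hG : IsPGroup p G) {N : Subgroup G} [N.Normal] (hN : N ≠ ⊥) :
    ∃ z ∈ N, z ∈ Subgroup.center G ∧ z ≠ 1 := by
  have hdvd : p ∣ Nat.card N := by
    refine ((hG.to_subgroup N).card_eq_or_dvd).resolve_left fun h => hN ?_
    exact N.card_eq_one.1 h
  obtain ⟨b, hb, hne⟩ :=
    (hG.of_equiv ConjAct.toConjAct).exists_fixed_point_of_prime_dvd_card_of_fixed_point N hdvd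
      (a := 1) (fun g => smul_one g)
  refine ⟨b, b.2, Subgroup.mem_center_iff.2 fun g => ?_, fun h => hne (Subtype.ext h.symm)⟩
  have h1 := congrArg Subtype.val (hb (ConjAct.toConjAct g))
  rw [ConjAct.Subgroup.val_conj_smul, ConjAct.toConjAct_smul] at h1
  rw [← h1]
  simp [mul_inv_eq_iff_eq_mul.1 h1]

theorem IsPGroup.le_center_of_card_prime {p : ℕ} (hp : p.Prime) [Finite G]
    (hG : IsPGroup p G) {N : Subgroup G} [N.Normal] (hN : Nat.card N = p) :
    N ≤ Subgroup.center G := by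
  have : Fact p.Prime := ⟨hp⟩
  obtain ⟨z, hzN, hzZ, hz⟩ := hG.exists_mem_inf_center (N := N) (by
    rintro rfl
    rw [Subgroup.card_bot] at hN
    exact hp.one_lt.ne hN)
  exact Subgroup.le_of_mem_of_card_prime hp hN hzN hzZ hz

theorem IsCyclic.mem_of_pow_eq_one [Finite G] [IsCyclic G] {p : ℕ} (hp : 0 < p)
    {H : Subgroup G} (hH : Nat.card H = p) {x : G} (hx : x ^ p = 1) : x ∈ H := by
  classical
  have := Fintype.ofFinite G
  have h1 : Finset.univ.filter (· ∈ H) ⊆ Finset.univ.filter fun y : G => y ^ p = 1 := by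
    intro y hy
    simp only [Finset.mem_filter, Finset.mem_univ, true_and] at hy ⊢
    rw [← hH]
    exact congrArg Subtype.val (pow_card_eq_one' (x := (⟨y, hy⟩ : H)))
  have h2 : (Finset.univ.filter (· ∈ H)).card = p := by
    rw [← hH, Nat.card_eq_fintype_card, Fintype.card_subtype]
  have h3 := Finset.eq_of_subset_of_card_le h1 (by rw [h2]; exact IsCyclic.card_pow_eq_one_le hp)
  have h4 : x ∈ Finset.univ.filter fun y : G => y ^ p = 1 := by simpa using hx
  rw [← h3] at h4
  simpa using h4

end PrimeSubgroups

section CommutatorPrime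

variable {G V : Type*} [Group G] [AddCommGroup V] [Module ℂ V] [FiniteDimensional ℂ V]
  {p : ℕ}

theorem Representation.apply_ne_one_of_mem_commutator (hp : p.Prime)
    (hc : Nat.card (commutator G) = p) {ρ : Representation ℂ G V} (h : ρ.IsIrreducible)
    (hd : finrank ℂ V ≠ 1) {z : G} (hz : z ∈ commutator G) (hz1 : z ≠ 1) : ρ z ≠ 1 := fun h1 =>
  hd <| h.finrank_eq_one_of_commutator_le_ker fun _ hg => MonoidHom.mem_ker.1 <|
    Subgroup.le_of_mem_of_card_prime (K := MonoidHom.ker ρ) hp hc hz h1 hz1 hg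

/-- Non-linear irreducible characters vanish off the center if the commutator subgroup is central
of prime order. -/
theorem Representation.character_eq_zero_of_notMem_center (hp : p.Prime)
    (hc : Nat.card (commutator G) = p) (hZ : commutator G ≤ Subgroup.center G)
    {ρ : Representation ℂ G V} (h : ρ.IsIrreducible) (hd : finrank ℂ V ≠ 1) {g : G}
    (hg : g ∉ Subgroup.center G) : ρ.character g = 0 := by
  rw [Subgroup.mem_center_iff] at hg
  push Not at hg
  obtain ⟨x, hx⟩ := hg
  have hz : x * g * x⁻¹ * g⁻¹ ∈ commutator G :=
    Subgroup.commutator_mem_commutator (Subgroup.mem_top x) (Subgroup.mem_top g)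
  refine h.character_eq_zero (hZ hz) (apply_ne_one_of_mem_commutator hp hc h hd hz fun h1 => ?_)
    (x := x) (by group)
  rw [mul_inv_eq_one, mul_inv_eq_iff_eq_mul] at h1
  exact hx h1

theorem Representation.finrank_sq_mul_card_center [Finite G] (hp : p.Prime)
    (hc : Nat.card (commutator G) = p) (hZ : commutator G ≤ Subgroup.center G)
    {ρ : Representation ℂ G V} (h : ρ.IsIrreducible) (hd : finrank ℂ V ≠ 1) :
    finrank ℂ V ^ 2 * Nat.card (Subgroup.center G) = Nat.card G :=
  h.finrank_sq_mul_card_center fun _ hg => character_eq_zero_of_notMem_center hp hc hZ h hd hg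

theorem Representation.injective_centralChar [Finite G] (hp : p.Prime) (hG : IsPGroup p G)
    [IsCyclic (Subgroup.center G)] (hc : Nat.card (commutator G) = p)
    (hZ : commutator G ≤ Subgroup.center G) {ρ : Representation ℂ G V} (h : ρ.IsIrreducible)
    (hd : finrank ℂ V ≠ 1) {μ : Subgroup.center G →* ℂ}
    (hμ : ∀ z : Subgroup.center G, ρ z = μ z • (1 : End ℂ V)) : Function.Injective μ := by
  have : Fact p.Prime := ⟨hp⟩
  rw [← MonoidHom.ker_eq_bot_iff]
  by_contra hker
  have hdvd : p ∣ Nat.card μ.ker :=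
    (((hG.to_subgroup _).to_subgroup μ.ker).card_eq_or_dvd).resolve_left
      fun h => hker (Subgroup.card_eq_one.1 h)
  obtain ⟨⟨x, hx⟩, hxp⟩ := exists_prime_orderOf_dvd_card' p hdvd
  rw [Subgroup.orderOf_mk] at hxp
  have hcard : Nat.card ((commutator G).subgroupOf (Subgroup.center G)) = p := by
    rw [Nat.card_congr (Subgroup.subgroupOfEquivOfLe hZ).toEquiv, hc]
  have hmem := IsCyclic.mem_of_pow_eq_one hp.pos hcard (x := x) (by rw [← hxp, pow_orderOf_eq_one])
  refine apply_ne_one_of_mem_commutator hp hc h hd (z := x) (Subgroup.mem_subgroupOf.1 hmem) ?_ ?_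
  · intro h1
    rw [← Subgroup.orderOf_coe, h1, orderOf_one] at hxp
    exact hp.one_lt.ne hxp
  · rw [hμ, MonoidHom.mem_ker.1 hx, one_smul]

end CommutatorPrime

section Galois

theorem isCyclotomicExtension_cyclotomicSubfield (n : ℕ) [NeZero n] :
    IsCyclotomicExtension {n} ℚ (cyclotomicSubfield n) := by
  have h := IntermediateField.isCyclotomicExtension_adjoin_of_exists_isPrimitiveRoot {n} ℚ ℂ
    fun m hm h0 => ⟨_, Complex.isPrimitiveRoot_exp m h0⟩
  have h2 : {b : ℂ | ∃ m ∈ ({n} : Set ℕ), m ≠ 0 ∧ b ^ m = 1} = {z : ℂ | z ^ n = 1} := by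
    ext b
    simp [NeZero.ne n]
  rw [h2] at h
  exact h

/-- Any two primitive `m`-th roots of unity are conjugate under `Gal(ℚ_n / ℚ)` if `m ∣ n`. -/
theorem exists_algEquiv_cyclotomicSubfield {n m : ℕ} (hn : n ≠ 0) (hm : m ∣ n) {a b : ℂ}
    (ha : IsPrimitiveRoot a m) (hb : IsPrimitiveRoot b m) :
    ∃ (σ : cyclotomicSubfield n ≃ₐ[ℚ] cyclotomicSubfield n) (x y : cyclotomicSubfield n),
      (x : ℂ) = a ∧ (y : ℂ) = b ∧ σ x = y := by
  have : NeZero n := ⟨hn⟩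
  have := isCyclotomicExtension_cyclotomicSubfield n
  have : IsGalois ℚ (cyclotomicSubfield n) := IsCyclotomicExtension.isGalois {n} ℚ _
  have hm0 : 0 < m := Nat.pos_of_dvd_of_pos hm (Nat.pos_of_ne_zero hn)
  have hmem : ∀ c : ℂ, IsPrimitiveRoot c m → c ∈ cyclotomicSubfield n := fun c hc =>
    IntermediateField.subset_adjoin ℚ _ ((hc.pow_eq_one_iff_dvd n).2 hm)
  let x : cyclotomicSubfield n := ⟨a, hmem a ha⟩
  let y : cyclotomicSubfield n := ⟨b, hmem b hb⟩
  have hx : IsPrimitiveRoot x m :=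
    IsPrimitiveRoot.of_map_of_injective (f := (cyclotomicSubfield n).val) ha Subtype.val_injective
  have hy : IsPrimitiveRoot y m :=
    IsPrimitiveRoot.of_map_of_injective (f := (cyclotomicSubfield n).val) hb Subtype.val_injective
  have hconj : IsConjRoot ℚ y x := by
    rw [isConjRoot_def, ← Polynomial.cyclotomic_eq_minpoly_rat hx hm0,
      ← Polynomial.cyclotomic_eq_minpoly_rat hy hm0]
  obtain ⟨σ, hσ⟩ := isConjRoot_iff_exists_algEquiv.1 hconj
  exact ⟨σ, x, y, rfl, rfl, hσ⟩

theorem GaloisConjugate.eq_one_of_eq_one {G : Type*} [Group G] {χ ψ : G → ℂ}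
    (h : GaloisConjugate χ ψ) {g : G} (hg : χ g = χ 1) : ψ g = ψ 1 := by
  obtain ⟨n, -, -, σ, hσ⟩ := h
  obtain ⟨x, hx, hx'⟩ := hσ g
  obtain ⟨y, hy, hy'⟩ := hσ 1
  have : x = y := Subtype.ext (by rw [hx, hy, hg])
  rw [← hx', ← hy', this]

theorem isGCStarGroup_of_isCyclic_center {p : ℕ} (hp : p.Prime) {P : Type*} [Group P] [Finite P]
    (hP : IsPGroup p P) [hcyc : IsCyclic (Subgroup.center P)]
    (hc : Nat.card (commutator P) = p) : IsGCStarGroup P := by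
  have hZ : commutator P ≤ Subgroup.center P := hP.le_center_of_card_prime hp hc
  rintro _ _ ⟨d, ρ, hρ, rfl⟩ ⟨e, τ, hτ, rfl⟩ hd he hde
  rw [Representation.char_one] at hd he
  rw [Representation.char_one, Representation.char_one] at hde
  have hd' : finrank ℂ (Fin d → ℂ) ≠ 1 := fun h => hd (by rw [h, Nat.cast_one])
  have he' : finrank ℂ (Fin e → ℂ) ≠ 1 := fun h => he (by rw [h, Nat.cast_one])
  obtain ⟨μ, hμ⟩ := hρ.exists_centralChar
  obtain ⟨ν, hν⟩ := hτ.exists_centralChar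
  have hμi := Representation.injective_centralChar hp hP hc hZ hρ hd' hμ
  have hνi := Representation.injective_centralChar hp hP hc hZ hτ he' hν
  obtain ⟨z, hz⟩ := hcyc.exists_generator
  have hzμ : IsPrimitiveRoot (μ z) (orderOf (z : P)) := by
    rw [Subgroup.orderOf_coe, ← orderOf_injective μ hμi]
    exact IsPrimitiveRoot.orderOf _
  have hzν : IsPrimitiveRoot (ν z) (orderOf (z : P)) := by
    rw [Subgroup.orderOf_coe, ← orderOf_injective ν hνi]
    exact IsPrimitiveRoot.orderOf _
  obtain ⟨σ, x, y, hx, hy, hσ⟩ := exists_algEquiv_cyclotomicSubfield (n := Nat.card P)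
    Nat.card_pos.ne' (orderOf_dvd_natCard _) hzμ hzν
  refine ⟨Nat.card P, Nat.card_pos.ne', dvd_rfl, σ, fun g => ?_⟩
  by_cases hg : g ∈ Subgroup.center P
  · have hgz : (⟨g, hg⟩ : Subgroup.center P) ∈ Submonoid.powers z :=
      (mem_powers_iff_mem_zpowers).2 (hz _)
    obtain ⟨k, hk⟩ := hgz
    have hk' : z ^ k = ⟨g, hg⟩ := hk
    refine ⟨x ^ k * (finrank ℂ (Fin d → ℂ) : cyclotomicSubfield (Nat.card P)), ?_, ?_⟩
    · rw [Representation.character_of_eq_smul_one (hμ ⟨g, hg⟩), ← hk', map_pow, ← hx]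
      push_cast
      rfl
    · rw [Representation.character_of_eq_smul_one (hν ⟨g, hg⟩), ← hk', map_pow, ← hy, map_mul,
        map_pow, hσ, map_natCast, ← hde]
      push_cast
      rfl
  · refine ⟨0, ?_, ?_⟩
    · rw [Representation.character_eq_zero_of_notMem_center hp hc hZ hρ hd' hg]
      simp
    · rw [Representation.character_eq_zero_of_notMem_center hp hc hZ hτ he' hg]
      simp

end Galois

section GCStar

variable {G V W : Type*} [Group G] [AddCommGroup V] [Module ℂ V] [FiniteDimensional ℂ V]
  [AddCommGroup W] [Module ℂ W] [FiniteDimensional ℂ W]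

theorem IsGCStarGroup.of_surjective {H : Type*} [Group H] (h : IsGCStarGroup G) {f : G →* H}
    (hf : Function.Surjective f) : IsGCStarGroup H := by
  rintro _ _ ⟨d, ρ, hρ, rfl⟩ ⟨e, τ, hτ, rfl⟩ hd he hde
  have key := h _ _ ⟨d, ρ.comp f, Representation.isIrreducible_comp hρ hf, rfl⟩
    ⟨e, τ.comp f, Representation.isIrreducible_comp hτ hf, rfl⟩
  simp only [Representation.char_one] at key hd he hde
  obtain ⟨n, hn, hdvd, σ, hσ⟩ := key hd he hde
  refine ⟨n, hn, (Subgroup.card_dvd_of_surjective f hf).trans hdvd, σ, fun y => ?_⟩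
  obtain ⟨x, rfl⟩ := hf y
  exact hσ x

/-- In a group all of whose non-linear irreducible characters of equal degree are Galois
conjugate, the kernels of two such characters contain the same central elements. -/
theorem IsGCStarGroup.apply_eq_one (h : IsGCStarGroup G) {ρ : Representation ℂ G V}
    {τ : Representation ℂ G W} (hρ : ρ.IsIrreducible) (hτ : τ.IsIrreducible)
    (hd : finrank ℂ V ≠ 1) (hde : finrank ℂ V = finrank ℂ W) {z : G}
    (hz : z ∈ Subgroup.center G) (hz1 : ρ z = 1) : τ z = 1 := by
  rw [← hτ.character_eq_iff hz]
  refine (h _ _ (isIrrChar_character hρ) (isIrrChar_character hτ) ?_ ?_ ?_).eq_one_of_eq_one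
    ((hρ.character_eq_iff hz).2 hz1)
  · rw [Representation.char_one]
    exact_mod_cast hd
  · rw [Representation.char_one]
    exact_mod_cast hde ▸ hd
  · rw [Representation.char_one, Representation.char_one, hde]

theorem exists_nonlinear_irreducible [Finite G] {z : G} (hz : z ∈ commutator G) (hz1 : z ≠ 1) :
    ∃ (d : ℕ) (ρ : Representation ℂ G (Fin d → ℂ)), ρ.IsIrreducible ∧
      finrank ℂ (Fin d → ℂ) ≠ 1 ∧ ρ z ≠ 1 := by
  obtain ⟨d, ρ, hρ, h1⟩ := exists_irreducible_apply_ne_one hz1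
  exact ⟨d, ρ, hρ, fun hd => h1 (Representation.apply_eq_one_of_mem_commutator hd hz), h1⟩

theorem IsGCStarGroup.isCyclic_center [Finite G] {p : ℕ} (hp : p.Prime) (h : IsGCStarGroup G)
    (hc : Nat.card (commutator G) = p) (hZ : commutator G ≤ Subgroup.center G) :
    IsCyclic (Subgroup.center G) := by
  have hbot : commutator G ≠ ⊥ := by
    intro hb
    rw [hb, Subgroup.card_bot] at hc
    exact hp.one_lt.ne hc
  obtain ⟨c, hcG, hc1⟩ := (commutator G).bot_or_exists_ne_one.resolve_left hbot
  obtain ⟨d, ρ, hρ, hd, -⟩ := exists_nonlinear_irreducible hcG hc1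
  have hdeg : ∀ {e : ℕ} {τ : Representation ℂ G (Fin e → ℂ)}, τ.IsIrreducible →
      finrank ℂ (Fin e → ℂ) ≠ 1 → finrank ℂ (Fin d → ℂ) = finrank ℂ (Fin e → ℂ) := by
    intro e τ hτ he
    have h1 := Representation.finrank_sq_mul_card_center hp hc hZ hρ hd
    have h2 := Representation.finrank_sq_mul_card_center hp hc hZ hτ he
    exact Nat.pow_left_injective two_ne_zero
      (Nat.eq_of_mul_eq_mul_right Nat.card_pos (h1.trans h2.symm))
  obtain ⟨μ, hμ⟩ := hρ.exists_centralChar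
  refine isCyclic_of_injective_ringHom μ ((injective_iff_map_eq_one' μ).2 fun z => ⟨fun hz => ?_,
    fun hz => by rw [hz, map_one]⟩)
  have hρz : ρ z = 1 := by rw [hμ, hz, one_smul]
  by_contra hz1
  obtain ⟨e, τ, hτ, hτz⟩ := exists_irreducible_apply_ne_one (g := (z : G))
    fun h => hz1 (Subtype.ext h)
  by_cases he : finrank ℂ (Fin e → ℂ) = 1
  · obtain ⟨ν, hν⟩ := Representation.exists_linear_of_finrank_eq_one (ρ := τ) he
    have h1 := h.apply_eq_one hρ (Representation.isIrreducible_twist hρ ν) hd rfl z.2 hρz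
    rw [Representation.twist_apply, hρz] at h1
    have : Nontrivial (Fin d → ℂ) := hρ.nontrivial'
    have h2 : ν z = 1 := smul_left_injective ℂ (one_ne_zero (α := End ℂ (Fin d → ℂ)))
      (h1.trans (one_smul ℂ _).symm)
    exact hτz (by rw [hν, h2, one_smul])
  · exact hτz (h.apply_eq_one hρ hτ hd (hdeg hτ he) z.2 hρz)

end GCStar

section AbelianSubgroup

variable {G V : Type*} [Group G] [AddCommGroup V] [Module ℂ V] [FiniteDimensional ℂ V]

theorem Subgroup.eq_or_eq_top_of_index_prime {A S : Subgroup G} (hA : A.index.Prime)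
    (hS : A ≤ S) : S = A ∨ S = ⊤ := by
  have h1 := Subgroup.relIndex_mul_index hS
  rcases (Nat.dvd_prime hA).1 (Dvd.intro_left _ h1) with h2 | h2
  · exact Or.inr (Subgroup.index_eq_one.1 h2)
  · left
    rw [h2] at h1
    have h3 : A.relIndex S = 1 := Nat.eq_of_mul_eq_mul_right hA.pos (h1.trans (one_mul _).symm)
    exact le_antisymm (Subgroup.relIndex_eq_one.1 h3) hS

theorem Representation.exists_common_eigenvector [Nontrivial V] (ρ : Representation ℂ G V)
    {A : Subgroup G} (hA : ∀ a ∈ A, ∀ b ∈ A, a * b = b * a) :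
    ∃ (v : V) (μ : G → ℂ), v ≠ 0 ∧ ∀ a ∈ A, ρ a v = μ a • v := by
  obtain ⟨W, ⟨hW0, hW⟩, hmin⟩ := wellFounded_lt.has_min
    {W : Submodule ℂ V | W ≠ ⊥ ∧ ∀ a ∈ A, ∀ v ∈ W, ρ a v ∈ W} ⟨⊤, top_ne_bot, by simp⟩
  have key : ∀ a ∈ A, ∃ c : ℂ, ∀ v ∈ W, ρ a v = c • v := by
    intro a ha
    have : Nontrivial W := Submodule.nontrivial_iff_ne_bot.2 hW0
    obtain ⟨c, hc⟩ := Module.End.exists_eigenvalue ((ρ a).restrict (hW a ha))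
    obtain ⟨⟨w, hw⟩, hwc, hw0⟩ := hc.exists_hasEigenvector
    rw [Module.End.mem_eigenspace_iff] at hwc
    have hwc' : ρ a w = c • w := congrArg Subtype.val hwc
    refine ⟨c, fun v hv => ?_⟩
    by_contra hne
    refine hmin (W ⊓ Module.End.eigenspace (ρ a) c) ⟨?_, ?_⟩ ?_
    · refine (Submodule.ne_bot_iff _).2 ⟨w, ⟨hw, Module.End.mem_eigenspace_iff.2 hwc'⟩, ?_⟩
      exact fun h => hw0 (Subtype.ext h)
    · rintro b hb u ⟨hu, hu'⟩
      refine ⟨hW b hb u hu, Module.End.mem_eigenspace_iff.2 ?_⟩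
      rw [← Module.End.mul_apply, ← map_mul, hA a ha b hb, map_mul, Module.End.mul_apply,
        Module.End.mem_eigenspace_iff.1 hu', map_smul]
    · refine lt_of_le_of_ne inf_le_left fun h => hne ?_
      exact Module.End.mem_eigenspace_iff.1 (inf_eq_left.1 h hv)
  obtain ⟨v, hv, hv0⟩ := Submodule.exists_mem_ne_zero_of_ne_bot hW0
  choose! μ hμ using key
  exact ⟨v, μ, hv0, fun a ha => hμ a ha v hv⟩

/-- The non-linear irreducible representations of a group with an abelian normal subgroup of prime
index `p` have degree `p`. -/
theorem Representation.IsIrreducible.finrank_eq_index {A : Subgroup G} [A.Normal]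
    (hA : ∀ a ∈ A, ∀ b ∈ A, a * b = b * a) (hp : A.index.Prime) {ρ : Representation ℂ G V}
    (h : ρ.IsIrreducible) (hd : finrank ℂ V ≠ 1) : finrank ℂ V = A.index := by
  have := h.nontrivial'
  have hAn : A.Normal := inferInstance
  obtain ⟨v, μ, hv, hμ⟩ := ρ.exists_common_eigenvector hA
  have hact : ∀ g, ∀ a ∈ A, ρ a (ρ g v) = μ (g⁻¹ * a * g) • ρ g v := by
    intro g a ha
    have h1 : g⁻¹ * a * g ∈ A := by simpa using hAn.conj_mem a ha g⁻¹
    rw [← map_smul, ← hμ _ h1, ← Module.End.mul_apply, ← Module.End.mul_apply, ← map_mul,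
      ← map_mul]
    congr 2
    group
  let S : Subgroup G :=
    { carrier := {g | ∀ a ∈ A, μ (g⁻¹ * a * g) = μ a}
      one_mem' := fun a _ => by simp
      mul_mem' := fun {x y} hx hy a ha => by
        have h1 : x⁻¹ * a * x ∈ A := by simpa using hAn.conj_mem a ha x⁻¹
        rw [← hx a ha, ← hy _ h1]
        congr 1
        group
      inv_mem' := fun {x} hx a ha => by
        rw [← hx _ (by simpa using hAn.conj_mem a ha x)]
        congr 1
        group }
  have hS : ∀ g, g ∈ S ↔ ∀ a ∈ A, μ (g⁻¹ * a * g) = μ a := fun g => Iff.rfl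
  have hAS : A ≤ S := fun x hx => (hS x).2 fun a ha => by
    rw [mul_assoc, hA a ha x hx, inv_mul_cancel_left]
  rcases Subgroup.eq_or_eq_top_of_index_prime hp hAS with hSA | hST
  · let w : G ⧸ A → V := fun q => ρ q.out v
    have hw0 : ∀ q, w q ≠ 0 := fun q h0 => hv <| by
      have : ρ (q.out)⁻¹ (w q) = v := by
        rw [← Module.End.mul_apply, ← map_mul, inv_mul_cancel, map_one, Module.End.one_apply]
      rw [← this, h0, map_zero]
    have hspan : Submodule.span ℂ (Set.range w) = ⊤ := by
      refine h.eq_top (fun g x hx => ?_) ?_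
      · refine Submodule.span_induction (p := fun x _ => ρ g x ∈ Submodule.span ℂ (Set.range w))
          ?_ ?_ ?_ ?_ hx
        · rintro _ ⟨q, rfl⟩
          obtain ⟨a, ha⟩ := QuotientGroup.mk_out_eq_mul A (g * q.out)
          have h1 : g * q.out = ((g * q.out : G) : G ⧸ A).out * (a : G)⁻¹ := by
            rw [ha]; group
          change ρ g (ρ q.out v) ∈ _
          rw [← Module.End.mul_apply, ← map_mul, h1, map_mul, Module.End.mul_apply,
            hμ _ (A.inv_mem a.2), map_smul]
          exact Submodule.smul_mem _ _ (Submodule.subset_span ⟨_, rfl⟩)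
        · rw [map_zero]; exact Submodule.zero_mem _
        · intro x y _ _ hx hy
          rw [map_add]; exact Submodule.add_mem _ hx hy
        · intro c x _ hx
          rw [map_smul]; exact Submodule.smul_mem _ _ hx
      · exact (Submodule.ne_bot_iff _).2 ⟨w (1 : G), Submodule.subset_span ⟨_, rfl⟩, hw0 _⟩
    let θ : G ⧸ A → A → ℂ := fun q a => μ (q.out⁻¹ * a * q.out)
    have hθ : Function.Injective θ := by
      intro q r hqr
      have h1 : r.out⁻¹ * q.out ∈ S := (hS _).2 fun a ha => by
        have h2 := congrFun hqr ⟨r.out * a * r.out⁻¹, hAn.conj_mem a ha _⟩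
        simp only [θ] at h2
        calc μ ((r.out⁻¹ * q.out)⁻¹ * a * (r.out⁻¹ * q.out))
            = μ (q.out⁻¹ * (r.out * a * r.out⁻¹) * q.out) := by congr 1; group
          _ = μ (r.out⁻¹ * (r.out * a * r.out⁻¹) * r.out) := h2
          _ = μ a := by congr 1; group
      rw [hSA] at h1
      have h2 := QuotientGroup.eq.2 h1
      rw [QuotientGroup.out_eq', QuotientGroup.out_eq'] at h2
      exact h2.symm
    have hind := Module.End.independent_iInf_maxGenEigenspace_of_forall_mapsTo
      (fun a : A => ρ a) (fun a b c => Module.End.mapsTo_maxGenEigenspace_of_comm (by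
        change ρ b * ρ a = ρ a * ρ b
        rw [← map_mul, ← map_mul, hA _ a.2 _ b.2]) c)
    have hli : LinearIndependent ℂ w := by
      refine (hind.comp hθ).linearIndependent _ (fun q => ?_) hw0
      refine (Submodule.mem_iInf _).2 fun a => ?_
      have h1 : w q ∈ Module.End.eigenspace (ρ a) (θ q a) :=
        Module.End.mem_eigenspace_iff.2 (hact _ a a.2)
      exact Module.End.genEigenspace_le_maximal (ρ a) (θ q a) 1 h1
    rw [Module.finrank_eq_nat_card_basis (Basis.mk hli hspan.ge)]
    rfl
  · exfalso
    have hall : ∀ a ∈ A, ∀ x, ρ a x = μ a • x := by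
      have hmem : ∀ x, x ∈ ⨅ a : A, Module.End.eigenspace (ρ a) (μ a) ↔
          ∀ a ∈ A, ρ a x = μ a • x := fun x => by
        simp [Submodule.mem_iInf]
      have htop : ⨅ a : A, Module.End.eigenspace (ρ a) (μ a) = ⊤ := by
        refine h.eq_top (fun g x hx => ?_) ((Submodule.ne_bot_iff _).2 ⟨v, (hmem v).2 hμ, hv⟩)
        rw [hmem] at hx ⊢
        intro a ha
        have h1 : g⁻¹ * a * g ∈ A := by simpa using hAn.conj_mem a ha g⁻¹
        have h2 : g ∈ S := hST ▸ Subgroup.mem_top g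
        rw [← (hS g).1 h2 a ha, ← map_smul, ← hx _ h1, ← Module.End.mul_apply,
          ← Module.End.mul_apply, ← map_mul, ← map_mul]
        congr 2
        group
      exact fun a ha x => (hmem x).1 (htop ▸ Submodule.mem_top) a ha
    have hne : A ≠ ⊤ := by
      rintro rfl
      rw [Subgroup.index_top] at hp
      exact Nat.not_prime_one hp
    obtain ⟨g, hg⟩ : ∃ g, g ∉ A := by
      by_contra! hcon
      exact hne ((Subgroup.eq_top_iff' A).2 hcon)
    obtain ⟨c, hc⟩ := Module.End.exists_eigenvalue (ρ g)
    obtain ⟨u, hu, hu0⟩ := hc.exists_hasEigenvector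
    rw [Module.End.mem_eigenspace_iff] at hu
    let T : Subgroup G :=
      { carrier := {x | ∃ c : ℂ, ρ x u = c • u}
        one_mem' := ⟨1, by simp⟩
        mul_mem' := by
          rintro x y ⟨a, ha⟩ ⟨b, hb⟩
          exact ⟨b * a, by rw [map_mul, Module.End.mul_apply, hb, map_smul, ha, smul_smul]⟩
        inv_mem' := by
          rintro x ⟨a, ha⟩
          have h1 : u = a • ρ x⁻¹ u := by
            rw [← map_smul, ← ha, ← Module.End.mul_apply, ← map_mul, inv_mul_cancel, map_one,
              Module.End.one_apply]
          have ha0 : a ≠ 0 := by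
            rintro rfl
            exact hu0 (by rw [h1, zero_smul])
          exact ⟨a⁻¹, by conv_rhs => rw [h1, smul_smul, inv_mul_cancel₀ ha0, one_smul]⟩ }
    have hT : T = ⊤ :=
      (Subgroup.eq_or_eq_top_of_index_prime hp (fun a ha => ⟨μ a, hall a ha u⟩ : A ≤ T)).resolve_left
        fun h => hg (h ▸ ⟨c, hu⟩)
    exact hd (h.finrank_eq_one_of_scalar hu0 fun x => (hT ▸ Subgroup.mem_top x : x ∈ T))

end AbelianSubgroup

section Commutators

open scoped commutatorElement

variable {G : Type*} [Group G]

/-- If commutators are central, `x ↦ ⁅x, g⁆` is a homomorphism. -/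
def commutatorHom (hZ : commutator G ≤ Subgroup.center G) (g : G) : G →* G where
  toFun x := ⁅x, g⁆
  map_one' := commutatorElement_one_left g
  map_mul' x y := by
    have h := Subgroup.mem_center_iff.1
      (hZ (Subgroup.commutator_mem_commutator (Subgroup.mem_top y) (Subgroup.mem_top g))) x
    have h' : x * ⁅y, g⁆ * x⁻¹ = ⁅y, g⁆ := by rw [h, mul_inv_cancel_right]
    calc ⁅x * y, g⁆ = x * ⁅y, g⁆ * x⁻¹ * ⁅x, g⁆ := by simp only [commutatorElement_def]; group
      _ = ⁅y, g⁆ * ⁅x, g⁆ := by rw [h']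
      _ = ⁅x, g⁆ * ⁅y, g⁆ := (Subgroup.mem_center_iff.1 (hZ (Subgroup.commutator_mem_commutator
          (Subgroup.mem_top y) (Subgroup.mem_top g))) _).symm

theorem commutatorElement_pow_left (hZ : commutator G ≤ Subgroup.center G) (x g : G) (n : ℕ) :
    ⁅x ^ n, g⁆ = ⁅x, g⁆ ^ n :=
  map_pow (commutatorHom hZ g) x n

theorem commutatorElement_pow_right (hZ : commutator G ≤ Subgroup.center G) (x g : G) (n : ℕ) :
    ⁅x, g ^ n⁆ = ⁅x, g⁆ ^ n := by
  rw [← commutatorElement_inv, commutatorElement_pow_left hZ, ← commutatorElement_inv x g,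
    inv_pow, inv_inv]

theorem Subgroup.mem_center_iff_commutatorElement {z : G} :
    z ∈ Subgroup.center G ↔ ∀ g : G, ⁅z, g⁆ = 1 := by
  simp_rw [Subgroup.mem_center_iff, commutatorElement_eq_one_iff_mul_comm, eq_comm]

theorem commutatorElement_mem_commutator (x y : G) : ⁅x, y⁆ ∈ commutator G :=
  Subgroup.commutator_mem_commutator (Subgroup.mem_top x) (Subgroup.mem_top y)

theorem QuotientGroup.mk_mem_center_iff {K : Subgroup G} [K.Normal] {z : G} :
    (z : G ⧸ K) ∈ Subgroup.center (G ⧸ K) ↔ ∀ g, ⁅z, g⁆ ∈ K := by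
  rw [Subgroup.mem_center_iff_commutatorElement]
  constructor
  · intro h g
    rw [← QuotientGroup.eq_one_iff]
    exact h g
  · intro h g
    obtain ⟨g, rfl⟩ := QuotientGroup.mk_surjective g
    exact (QuotientGroup.eq_one_iff _).2 (h g)

theorem Subgroup.normal_of_le_center {K : Subgroup G} (hK : K ≤ Subgroup.center G) : K.Normal :=
  ⟨fun n hn g => by rwa [Subgroup.mem_center_iff.1 (hK hn) g, mul_inv_cancel_right]⟩

theorem QuotientGroup.commutator_eq_map (K : Subgroup G) [K.Normal] :
    commutator (G ⧸ K) = (commutator G).map (QuotientGroup.mk' K) := by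
  rw [commutator_def, commutator_def, Subgroup.map_commutator,
    Subgroup.map_top_of_surjective _ (QuotientGroup.mk'_surjective K)]

theorem QuotientGroup.card_commutator_mul_card {K : Subgroup G} [K.Normal]
    (hK : K ≤ commutator G) :
    Nat.card (commutator (G ⧸ K)) * Nat.card K = Nat.card (commutator G) := by
  have h := Subgroup.card_mul_index ((QuotientGroup.mk' K).subgroupMap (commutator G)).ker
  rw [Subgroup.index_ker, MonoidHom.range_eq_top.2
    (MonoidHom.subgroupMap_surjective _ _), Subgroup.card_top] at h
  rw [← h, QuotientGroup.commutator_eq_map, mul_comm]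
  congr 1
  have h2 : ((QuotientGroup.mk' K).subgroupMap (commutator G)).ker =
      K.subgroupOf (commutator G) := by
    ext x
    rw [MonoidHom.mem_ker, Subtype.ext_iff, Subgroup.mem_subgroupOf]
    exact QuotientGroup.eq_one_iff _
  rw [h2, Nat.card_congr (Subgroup.subgroupOfEquivOfLe hK).toEquiv]

theorem pow_eq_one_of_mem_of_card {K : Subgroup G} {p : ℕ} (hK : Nat.card K = p) {c : G}
    (hc : c ∈ K) : c ^ p = 1 := by
  have : (⟨c, hc⟩ : K) ^ Nat.card K = 1 := pow_card_eq_one'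
  rw [hK] at this
  exact congrArg Subtype.val this

theorem pow_mem_center_of_commutatorElement_mem {K : Subgroup G} (hKZ : K ≤ Subgroup.center G)
    {p : ℕ} (hK : Nat.card K = p) {w : G} (hw : ∀ g, ⁅w, g⁆ ∈ K) : w ^ p ∈ Subgroup.center G := by
  rw [Subgroup.mem_center_iff]
  intro g
  have h1 : g * w * g⁻¹ = ⁅g, w⁆ * w := by rw [commutatorElement_def]; group
  have h2 : ⁅g, w⁆ ∈ K := by rw [← commutatorElement_inv]; exact K.inv_mem (hw g)
  have h3 : Commute ⁅g, w⁆ w := (Subgroup.mem_center_iff.1 (hKZ h2) w).symm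
  have h4 : g * w ^ p * g⁻¹ = w ^ p := by
    rw [← conj_pow, h1, h3.mul_pow, pow_eq_one_of_mem_of_card hK h2, one_mul]
  exact mul_inv_eq_iff_eq_mul.1 h4

/-- Let `K` be central of prime order, with `Z(G / K)` cyclic. An element that commutes with some
non-central `a` with `aK ∈ Z(G / K)` commutes with every `b` with `bK ∈ Z(G / K)`. -/
theorem commute_of_isCyclic_center_quotient {p : ℕ} (hp : p.Prime) {K : Subgroup G} [K.Normal]
    (hKZ : K ≤ Subgroup.center G) (hK : Nat.card K = p) [hcyc : IsCyclic (Subgroup.center (G ⧸ K))]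
    {a b g : G} (ha : ∀ x, ⁅a, x⁆ ∈ K) (hb : ∀ x, ⁅b, x⁆ ∈ K) (haZ : a ∉ Subgroup.center G)
    (hga : Commute g a) : Commute g b := by
  obtain ⟨⟨w', hw'⟩, hgen⟩ := hcyc.exists_generator
  obtain ⟨w, rfl⟩ := QuotientGroup.mk_surjective w'
  have hw := QuotientGroup.mk_mem_center_iff.1 hw'
  have hwp := pow_mem_center_of_commutatorElement_mem hKZ hK hw
  have hex : ∀ c : G, (∀ x, ⁅c, x⁆ ∈ K) → ∃ i : ℤ, ∃ k ∈ K, c = w ^ i * k := by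
    intro c hc
    obtain ⟨i, hi⟩ := Subgroup.mem_zpowers_iff.1
      (hgen ⟨c, QuotientGroup.mk_mem_center_iff.2 hc⟩)
    have hi' : ((w ^ i : G) : G ⧸ K) = c := congrArg Subtype.val hi
    exact ⟨i, _, QuotientGroup.eq.1 hi', by group⟩
  have hcent : ∀ z ∈ Subgroup.center G, Commute g z := fun z hz => Subgroup.mem_center_iff.1 hz g
  obtain ⟨i, k, hk, rfl⟩ := hex a ha
  obtain ⟨j, l, hl, rfl⟩ := hex b hb
  have hi : ¬ (p : ℤ) ∣ i := by
    rintro ⟨m, rfl⟩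
    apply haZ
    rw [zpow_mul, zpow_natCast]
    exact mul_mem (zpow_mem hwp m) (hKZ hk)
  have hcop : IsCoprime (p : ℤ) i := (Nat.prime_iff_prime_int.1 hp).coprime_iff_not_dvd.2 hi
  obtain ⟨u, v, huv⟩ := hcop
  have hwi : Commute g (w ^ i) := by
    have := hga.mul_right (hcent _ (hKZ (K.inv_mem hk)))
    rwa [mul_inv_cancel_right] at this
  have hgw : Commute g w := by
    have h1 : w = (w ^ p) ^ u * (w ^ i) ^ v := by
      rw [← zpow_natCast, ← zpow_mul, ← zpow_mul, ← zpow_add, mul_comm (p : ℤ), mul_comm i, huv,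
        zpow_one]
    rw [h1]
    exact ((hcent _ hwp).zpow_right u).mul_right (hwi.zpow_right v)
  exact (hgw.zpow_right j).mul_right (hcent _ (hKZ hl))

theorem IsCyclic.index_dvd_of_pow_mem [IsCyclic G] {p : ℕ} {Y : Subgroup G}
    (hY : ∀ c, c ^ p ∈ Y) : Y.index ∣ p := by
  have : Y.Normal := ⟨fun n hn g => by
    rwa [IsCyclic.isMulCommutative.is_comm.comm g n, mul_inv_cancel_right]⟩
  have : IsCyclic (G ⧸ Y) :=
    isCyclic_of_surjective (QuotientGroup.mk' Y) (QuotientGroup.mk'_surjective Y)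
  rw [Subgroup.index, ← IsCyclic.exponent_eq_card]
  refine Monoid.exponent_dvd_of_forall_pow_eq_one fun c => ?_
  obtain ⟨c, rfl⟩ := QuotientGroup.mk_surjective c
  exact (QuotientGroup.eq_one_iff _).2 (hY c)

/-- If `K` is central of prime order and `Z(G / K)` is cyclic, then the image of `Z(G)` has index
`1` or `p` in `Z(G / K)`. -/
theorem card_center_quotient [Finite G] {p : ℕ} (hp : p.Prime) {K : Subgroup G}
    [K.Normal] (hKZ : K ≤ Subgroup.center G) (hK : Nat.card K = p)
    [IsCyclic (Subgroup.center (G ⧸ K))] :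
    ∃ r, (r = 1 ∨ r = p) ∧
      Nat.card (Subgroup.center (G ⧸ K)) * p = Nat.card (Subgroup.center G) * r := by
  let f : Subgroup.center G →* Subgroup.center (G ⧸ K) :=
    ((QuotientGroup.mk' K).comp (Subgroup.center G).subtype).codRestrict _ fun z =>
      QuotientGroup.mk_mem_center_iff.2 fun g => by
        have h := Subgroup.mem_center_iff_commutatorElement.1 z.2 g
        exact (congrArg (· ∈ K) h).mpr K.one_mem
  have hdvd : f.range.index ∣ p := by
    refine IsCyclic.index_dvd_of_pow_mem ?_
    rintro ⟨c, hc⟩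
    obtain ⟨c, rfl⟩ := QuotientGroup.mk_surjective c
    exact ⟨⟨c ^ p, pow_mem_center_of_commutatorElement_mem hKZ hK
      (QuotientGroup.mk_mem_center_iff.1 hc)⟩, Subtype.ext rfl⟩
  have hker : Nat.card f.ker = p := by
    have h2 : f.ker = K.subgroupOf (Subgroup.center G) := by
      ext x
      rw [MonoidHom.mem_ker, Subtype.ext_iff, Subgroup.mem_subgroupOf]
      exact QuotientGroup.eq_one_iff _
    rw [h2, Nat.card_congr (Subgroup.subgroupOfEquivOfLe hKZ).toEquiv, hK]
  refine ⟨f.range.index, (Nat.dvd_prime hp).1 hdvd, ?_⟩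
  have h3 := Subgroup.card_mul_index f.ker
  rw [Subgroup.index_ker, hker] at h3
  rw [← Subgroup.card_mul_index f.range, ← h3]
  ring

end Commutators

section CommutatorPrimeSquare

open scoped commutatorElement

variable {P : Type*} [Group P] {p : ℕ}

theorem card_commutator_quotient_of_sq (hp : p.Prime) (hc : Nat.card (commutator P) = p ^ 2)
    {K : Subgroup P} [K.Normal] (hKc : K ≤ commutator P) (hK : Nat.card K = p) :
    Nat.card (commutator (P ⧸ K)) = p := by
  have h := QuotientGroup.card_commutator_mul_card hKc
  rw [hc, hK, sq] at h
  exact Nat.eq_of_mul_eq_mul_right hp.pos h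

theorem QuotientGroup.mk_mem_commutator {K : Subgroup P} [K.Normal] {t : P}
    (ht : t ∈ commutator P) : (t : P ⧸ K) ∈ commutator (P ⧸ K) := by
  rw [QuotientGroup.commutator_eq_map]
  exact ⟨t, ht, rfl⟩

variable [Finite P]

theorem commutator_quotient_le_center (hp : p.Prime) (hP : IsPGroup p P)
    (hc : Nat.card (commutator P) = p ^ 2) {K : Subgroup P} [K.Normal] (hKc : K ≤ commutator P)
    (hK : Nat.card K = p) : commutator (P ⧸ K) ≤ Subgroup.center (P ⧸ K) :=
  (hP.to_quotient K).le_center_of_card_prime hp (card_commutator_quotient_of_sq hp hc hKc hK)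

theorem IsGCStarGroup.isCyclic_center_quotient (hp : p.Prime) (hP : IsPGroup p P)
    (h : IsGCStarGroup P) (hc : Nat.card (commutator P) = p ^ 2) {K : Subgroup P} [K.Normal]
    (hKc : K ≤ commutator P) (hK : Nat.card K = p) : IsCyclic (Subgroup.center (P ⧸ K)) :=
  (h.of_surjective (QuotientGroup.mk'_surjective K)).isCyclic_center hp
    (card_commutator_quotient_of_sq hp hc hKc hK) (commutator_quotient_le_center hp hP hc hKc hK)

theorem exists_mem_commutator_notMem (hp : p.Prime) (hc : Nat.card (commutator P) = p ^ 2)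
    {K : Subgroup P} (hK : Nat.card K = p) : ∃ x y : P, ⁅x, y⁆ ∉ K := by
  by_contra! hcon
  have h1 : commutator P ≤ K := Subgroup.commutator_le.2 fun x _ y _ => hcon x y
  have h2 := Subgroup.card_le_of_le h1
  rw [hc, hK] at h2
  nlinarith [hp.one_lt]

theorem exists_nonlinear_irreducible_quotient (hp : p.Prime) (hc : Nat.card (commutator P) = p ^ 2)
    {K : Subgroup P} [K.Normal] (hK : Nat.card K = p) :
    ∃ (d : ℕ) (ρ : Representation ℂ (P ⧸ K) (Fin d → ℂ)),
      ρ.IsIrreducible ∧ finrank ℂ (Fin d → ℂ) ≠ 1 := by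
  obtain ⟨x, y, hxy⟩ := exists_mem_commutator_notMem hp hc hK
  obtain ⟨d, ρ, hρ, hd, -⟩ := exists_nonlinear_irreducible
    (QuotientGroup.mk_mem_commutator (K := K) (commutatorElement_mem_commutator x y))
    fun h => hxy ((QuotientGroup.eq_one_iff _).1 h)
  exact ⟨d, ρ, hρ, hd⟩

theorem Nat.eq_of_sq_mul_eq (hp : p.Prime) {d e r s : ℕ} (hd : d ≠ 0) (he : e ≠ 0)
    (hr : r = 1 ∨ r = p) (hs : s = 1 ∨ s = p) (h : d ^ 2 * r = e ^ 2 * s) : d = e := by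
  have key : ∀ {a b : ℕ}, a ≠ 0 → b ≠ 0 → a ^ 2 ≠ b ^ 2 * p := by
    intro a b ha hb hab
    have : Fact p.Prime := ⟨hp⟩
    have h1 := congrArg (padicValNat p) hab
    rw [padicValNat.mul (pow_ne_zero 2 hb) hp.ne_zero, padicValNat.pow, padicValNat.pow,
      padicValNat_self] at h1
    omega
  rcases hr with rfl | rfl <;> rcases hs with rfl | rfl
  · exact Nat.pow_left_injective two_ne_zero (by simpa using h)
  · exact absurd (by simpa using h) (key hd he)
  · exact absurd (by simpa using h.symm) (key he hd)
  · exact Nat.pow_left_injective two_ne_zero (Nat.eq_of_mul_eq_mul_right hp.pos h)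

/-- In class two, commutators have order dividing `p`. -/
theorem IsGCStarGroup.commutatorElement_pow_eq_one (hp : p.Prime) (hP : IsPGroup p P)
    (h : IsGCStarGroup P) (hc : Nat.card (commutator P) = p ^ 2)
    (hZ : commutator P ≤ Subgroup.center P) {K : Subgroup P} (hKc : K ≤ commutator P)
    (hK : Nat.card K = p) (x y : P) : ⁅x, y⁆ ^ p = 1 := by
  have hKZ := hKc.trans hZ
  have : K.Normal := Subgroup.normal_of_le_center hKZ
  have := h.isCyclic_center_quotient hp hP hc hKc hK
  have hpow : ∀ c ∈ commutator P, c ^ p ∈ K := fun c hc' => by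
    rw [← QuotientGroup.eq_one_iff, QuotientGroup.mk_pow]
    exact pow_eq_one_of_mem_of_card (card_commutator_quotient_of_sq hp hc hKc hK)
      (QuotientGroup.mk_mem_commutator hc')
  have hmem : ∀ a g : P, ⁅a ^ p, g⁆ ∈ K := fun a g => by
    rw [commutatorElement_pow_left hZ]
    exact hpow _ (commutatorElement_mem_commutator a g)
  by_contra hne
  have hx : x ^ p ∉ Subgroup.center P := fun hx => hne <| by
    rw [← commutatorElement_pow_left hZ]
    exact Subgroup.mem_center_iff_commutatorElement.1 hx y
  have hcomm : Commute x (y ^ p) := commute_of_isCyclic_center_quotient hp hKZ hK (hmem x)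
    (hmem y) hx ((Commute.refl x).pow_right p)
  exact hne (by
    rw [← commutatorElement_pow_right hZ, commutatorElement_eq_one_iff_mul_comm.2 hcomm.eq])

theorem IsGCStarGroup.not_commutator_le_center (hp : p.Prime) (hP : IsPGroup p P)
    (h : IsGCStarGroup P) (hc : Nat.card (commutator P) = p ^ 2) {K : Subgroup P}
    (hKc : K ≤ commutator P) (hK : Nat.card K = p) : ¬ commutator P ≤ Subgroup.center P := by
  intro hZ
  obtain ⟨x, y, hxy⟩ := exists_mem_commutator_notMem hp hc hK
  have hord : orderOf ⁅x, y⁆ = p := by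
    have : Fact p.Prime := ⟨hp⟩
    exact orderOf_eq_prime (h.commutatorElement_pow_eq_one hp hP hc hZ hKc hK x y)
      fun h1 => hxy (h1 ▸ K.one_mem)
  set L := Subgroup.zpowers ⁅x, y⁆ with hLdef
  have hLc : L ≤ commutator P := (Subgroup.zpowers_le).2 (commutatorElement_mem_commutator x y)
  have hL : Nat.card L = p := by rw [hLdef, Nat.card_zpowers, hord]
  have hKn : K.Normal := Subgroup.normal_of_le_center (hKc.trans hZ)
  have hLn : L.Normal := Subgroup.normal_of_le_center (hLc.trans hZ)
  have := h.isCyclic_center_quotient hp hP hc hKc hK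
  have := h.isCyclic_center_quotient hp hP hc hLc hL
  have hcK := card_commutator_quotient_of_sq hp hc hKc hK
  have hcL := card_commutator_quotient_of_sq hp hc hLc hL
  obtain ⟨d, ρ, hρ, hd⟩ := exists_nonlinear_irreducible_quotient hp hc hK
  obtain ⟨e, τ, hτ, he⟩ := exists_nonlinear_irreducible_quotient hp hc hL
  obtain ⟨r, hr, hr'⟩ := card_center_quotient hp (hKc.trans hZ) hK
  obtain ⟨s, hs, hs'⟩ := card_center_quotient hp (hLc.trans hZ) hL
  have h1 := Representation.finrank_sq_mul_card_center hp hcK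
    (commutator_quotient_le_center hp hP hc hKc hK) hρ hd
  have h2 := Representation.finrank_sq_mul_card_center hp hcL
    (commutator_quotient_le_center hp hP hc hLc hL) hτ he
  have h3 := Subgroup.card_eq_card_quotient_mul_card_subgroup K
  have h4 := Subgroup.card_eq_card_quotient_mul_card_subgroup L
  rw [← h1, hK, mul_assoc, hr'] at h3
  rw [← h2, hL, mul_assoc, hs', h3] at h4
  have := hρ.nontrivial'
  have := hτ.nontrivial'
  have hde : finrank ℂ (Fin e → ℂ) = finrank ℂ (Fin d → ℂ) := by
    refine Nat.eq_of_sq_mul_eq hp finrank_pos.ne' finrank_pos.ne' hs hr ?_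
    refine Nat.eq_of_mul_eq_mul_left (Nat.card_pos (α := Subgroup.center P)) ?_
    linear_combination -h4
  have h5 := h.apply_eq_one
    (Representation.isIrreducible_comp hτ (QuotientGroup.mk'_surjective L))
    (Representation.isIrreducible_comp hρ (QuotientGroup.mk'_surjective K)) he hde
    (z := ⁅x, y⁆) (hZ (commutatorElement_mem_commutator x y)) (by
      have : QuotientGroup.mk' L ⁅x, y⁆ = 1 :=
        (QuotientGroup.eq_one_iff _).2 (Subgroup.mem_zpowers _)
      change τ (QuotientGroup.mk' L ⁅x, y⁆) = 1
      rw [this, map_one])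
  exact Representation.apply_ne_one_of_mem_commutator hp hcK hρ hd
    (QuotientGroup.mk_mem_commutator (commutatorElement_mem_commutator x y))
    (fun h => hxy ((QuotientGroup.eq_one_iff _).1 h)) h5

/-- If the commutator subgroup has order `p ^ 2` and is not central, there is an abelian normal
subgroup of index `p`. -/
theorem IsGCStarGroup.exists_abelian_index_prime (hp : p.Prime) (hP : IsPGroup p P)
    (h : IsGCStarGroup P) (hc : Nat.card (commutator P) = p ^ 2) {K : Subgroup P}
    (hKc : K ≤ commutator P) (hKZ : K ≤ Subgroup.center P) (hK : Nat.card K = p)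
    (hZ : ¬ commutator P ≤ Subgroup.center P) :
    ∃ A : Subgroup P, A.Normal ∧ A.index = p ∧ ∀ a ∈ A, ∀ b ∈ A, a * b = b * a := by
  have hKn : K.Normal := Subgroup.normal_of_le_center hKZ
  have := h.isCyclic_center_quotient hp hP hc hKc hK
  have hcK := card_commutator_quotient_of_sq hp hc hKc hK
  have hcZ := commutator_quotient_le_center hp hP hc hKc hK
  obtain ⟨t, htc, htZ⟩ := Set.not_subset.1 hZ
  have hcomK : ∀ c ∈ commutator P, ∀ g, ⁅c, g⁆ ∈ K := fun c hc =>
    QuotientGroup.mk_mem_center_iff.1 (hcZ (QuotientGroup.mk_mem_commutator hc))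
  have htK := hcomK t htc
  have hgt : ∀ g, ⁅g, t⁆ ∈ K := fun g => by
    rw [← commutatorElement_inv]; exact K.inv_mem (htK g)
  have hcent : ∀ {g b : P}, Commute g t → (∀ x, ⁅b, x⁆ ∈ K) → Commute g b := fun hg hb =>
    commute_of_isCyclic_center_quotient hp hKZ hK htK hb htZ hg
  let f : P →* K :=
    { toFun := fun g => ⟨⁅g, t⁆, hgt g⟩
      map_one' := Subtype.ext (commutatorElement_one_left t)
      map_mul' := fun x y => Subtype.ext <| by
        have h1 := Subgroup.mem_center_iff.1 (hKZ (hgt y))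
        have h' : x * ⁅y, t⁆ * x⁻¹ = ⁅y, t⁆ := by rw [h1, mul_inv_cancel_right]
        calc ⁅x * y, t⁆ = x * ⁅y, t⁆ * x⁻¹ * ⁅x, t⁆ := by
              simp only [commutatorElement_def]; group
          _ = ⁅x, t⁆ * ⁅y, t⁆ := by rw [h', h1] }
  have hfker : ∀ g, g ∈ f.ker ↔ Commute g t := fun g => by
    rw [MonoidHom.mem_ker, Subtype.ext_iff]
    exact commutatorElement_eq_one_iff_mul_comm
  have hindex : f.ker.index = p := by
    rw [Subgroup.index_ker]
    refine ((Nat.dvd_prime hp).1 (hK ▸ Subgroup.card_subgroup_dvd_card f.range)).resolve_left ?_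
    intro h1
    rw [Subgroup.card_eq_one] at h1
    refine htZ (Subgroup.mem_center_iff.2 fun g => ((hfker g).1 ?_).eq)
    rw [MonoidHom.range_eq_bot_iff.1 h1, MonoidHom.mem_ker, MonoidHom.one_apply]
  have hprime : f.ker.index.Prime := hindex ▸ hp
  -- commutators of elements of the kernel lie in `K`
  have hAK : ∀ x ∈ f.ker, ∀ y ∈ f.ker, ⁅x, y⁆ ∈ K := by
    intro x hx y hy
    rw [hfker] at hx hy
    have hcc : ∀ g a : P, ∃ u ∈ commutator P, g * a * g⁻¹ = u * a := fun g a =>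
      ⟨⁅g, a⁆, commutatorElement_mem_commutator g a, by rw [commutatorElement_def]; group⟩
    have hcen : ⁅x, y⁆ ∈ Subgroup.center P := by
      rw [Subgroup.mem_center_iff]
      intro g
      obtain ⟨u, hu, hxu⟩ := hcc g x
      obtain ⟨v, hv, hyv⟩ := hcc g y
      have hxu' : Commute x u := hcent hx (hcomK u hu)
      have hxv : Commute x v := hcent hx (hcomK v hv)
      have hyu : Commute y u := hcent hy (hcomK u hu)
      have hyv' : Commute y v := hcent hy (hcomK v hv)
      have htu : Commute t u := hcent (Commute.refl t) (hcomK u hu)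
      have huv : Commute u v := hcent htu.symm (hcomK v hv)
      have h1 : g * ⁅x, y⁆ * g⁻¹ = ⁅u * x, v * y⁆ := by
        rw [← hxu, ← hyv]
        simp only [commutatorElement_def]
        group
      have h2 : ⁅u * x, v * y⁆ = ⁅x, y⁆ := by
        have hu1 : Commute u (x * y * x⁻¹) :=
          (hxu'.symm.mul_right hyu.symm).mul_right hxu'.symm.inv_right
        have hv1 : Commute v ⁅x, y⁆ :=
          ((hxv.symm.mul_right hyv'.symm).mul_right hxv.symm.inv_right).mul_right
            hyv'.symm.inv_right
        calc ⁅u * x, v * y⁆ = u * (x * v) * y * x⁻¹ * u⁻¹ * y⁻¹ * v⁻¹ := by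
              rw [commutatorElement_def]; group
          _ = u * v * (x * y * x⁻¹) * u⁻¹ * y⁻¹ * v⁻¹ := by rw [hxv.eq]; group
          _ = v * (u * (x * y * x⁻¹)) * u⁻¹ * y⁻¹ * v⁻¹ := by rw [huv.eq]; group
          _ = v * ⁅x, y⁆ * v⁻¹ := by rw [hu1.eq, commutatorElement_def]; group
          _ = ⁅x, y⁆ := by rw [hv1.eq, mul_inv_cancel_right]
      exact mul_inv_eq_iff_eq_mul.1 (h1.trans h2)
    by_contra hnK
    have h3 : commutator (P ⧸ K) ≤ (Subgroup.center P).map (QuotientGroup.mk' K) :=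
      Subgroup.le_of_mem_of_card_prime hp hcK
        (QuotientGroup.mk_mem_commutator (commutatorElement_mem_commutator x y))
        ⟨_, hcen, rfl⟩ fun h => hnK ((QuotientGroup.eq_one_iff _).1 h)
    obtain ⟨z, hz, hzt⟩ := h3 (QuotientGroup.mk_mem_commutator htc)
    have h4 : z⁻¹ * t ∈ K := QuotientGroup.eq.1 hzt
    have h5 := mul_mem hz (hKZ h4)
    rw [mul_inv_cancel_left] at h5
    exact htZ h5
  obtain ⟨g, hg⟩ : ∃ g, g ∉ f.ker := by
    by_contra! hcon
    rw [(Subgroup.eq_top_iff' _).2 hcon, Subgroup.index_top] at hprime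
    exact Nat.not_prime_one hprime
  -- an element of the kernel is central modulo `K` if it commutes with `g` modulo `K`
  have hmod : ∀ x ∈ f.ker, ⁅x, g⁆ ∈ K → ∀ y, ⁅x, y⁆ ∈ K := by
    intro x hx hxg
    have htop : (Subgroup.centralizer {(x : P ⧸ K)}).comap (QuotientGroup.mk' K) = ⊤ := by
      have hmem : ∀ y, y ∈ (Subgroup.centralizer {(x : P ⧸ K)}).comap (QuotientGroup.mk' K) ↔
          ⁅x, y⁆ ∈ K := fun y => by
        rw [Subgroup.mem_comap, Subgroup.mem_centralizer_singleton_iff, ← QuotientGroup.eq_one_iff,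
          eq_comm]
        exact commutatorElement_eq_one_iff_mul_comm.symm
      refine (Subgroup.eq_or_eq_top_of_index_prime hprime fun y hy =>
        (hmem y).2 (hAK x hx y hy)).resolve_left fun h => hg ?_
      rw [← h]
      exact (hmem g).2 hxg
    intro y
    have hy : y ∈ (Subgroup.centralizer {(x : P ⧸ K)}).comap (QuotientGroup.mk' K) :=
      htop ▸ Subgroup.mem_top y
    rw [Subgroup.mem_comap, Subgroup.mem_centralizer_singleton_iff] at hy
    rw [← QuotientGroup.eq_one_iff]
    exact commutatorElement_eq_one_iff_mul_comm.2 hy.symm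
  refine ⟨f.ker, inferInstance, hindex, fun x hx y hy => ?_⟩
  by_cases hxg : ⁅x, g⁆ ∈ K
  · exact (hcent ((hfker y).1 hy) (hmod x hx hxg)).eq.symm
  · have h1 : ((⁅y, g⁆ : P) : P ⧸ K) ∈ Subgroup.zpowers ((⁅x, g⁆ : P) : P ⧸ K) :=
      Subgroup.le_of_mem_of_card_prime hp hcK
        (QuotientGroup.mk_mem_commutator (commutatorElement_mem_commutator x g))
        (Subgroup.mem_zpowers _) (fun h => hxg ((QuotientGroup.eq_one_iff _).1 h))
        (QuotientGroup.mk_mem_commutator (commutatorElement_mem_commutator y g))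
    obtain ⟨i, hi⟩ := Subgroup.mem_zpowers_iff.1 h1
    have hi' : commutatorHom hcZ (g : P ⧸ K) (x : P ⧸ K) ^ i =
      commutatorHom hcZ (g : P ⧸ K) (y : P ⧸ K) := hi
    have h2 : commutatorHom hcZ (g : P ⧸ K) ((x ^ (-i) * y : P) : P ⧸ K) = 1 := by
      rw [QuotientGroup.mk_mul, QuotientGroup.mk_zpow, map_mul, map_zpow, ← hi', zpow_neg,
        inv_mul_cancel]
    have h3 := hmod (x ^ (-i) * y) (mul_mem (zpow_mem hx _) hy) ((QuotientGroup.eq_one_iff _).1 h2)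
    have h4 : Commute x (x ^ (-i) * y) := hcent ((hfker x).1 hx) h3
    have h5 := ((Commute.refl x).zpow_right i).mul_right h4
    rw [zpow_neg, mul_inv_cancel_left] at h5
    exact h5.eq

theorem IsGCStarGroup.card_commutator_ne_sq (hp : p.Prime) (hP : IsPGroup p P)
    (h : IsGCStarGroup P) {K : Subgroup P} (hKc : K ≤ commutator P)
    (hKZ : K ≤ Subgroup.center P) (hK : Nat.card K = p) : Nat.card (commutator P) ≠ p ^ 2 := by
  intro hc
  obtain ⟨A, hAn, hAi, hA⟩ := h.exists_abelian_index_prime hp hP hc hKc hKZ hK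
    (h.not_commutator_le_center hp hP hc hKc hK)
  have hKn : K.Normal := Subgroup.normal_of_le_center hKZ
  obtain ⟨k, hk, hk1⟩ := K.bot_or_exists_ne_one.resolve_left (by
    rintro rfl
    rw [Subgroup.card_bot] at hK
    exact hp.one_lt.ne hK)
  obtain ⟨d, ρ, hρ, hd⟩ := exists_nonlinear_irreducible_quotient hp hc hK
  obtain ⟨e, τ, hτ, he, hτk⟩ := exists_nonlinear_irreducible (hKc hk) hk1
  have hρ' := Representation.isIrreducible_comp hρ (QuotientGroup.mk'_surjective K)
  have hprime : A.index.Prime := hAi ▸ hp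
  refine hτk (h.apply_eq_one hρ' hτ hd ?_ (hKZ hk) ?_)
  · rw [hρ'.finrank_eq_index hA hprime hd, hτ.finrank_eq_index hA hprime he]
  · have : QuotientGroup.mk' K k = 1 := (QuotientGroup.eq_one_iff _).2 hk
    change ρ (QuotientGroup.mk' K k) = 1
    rw [this, map_one]

end CommutatorPrimeSquare

theorem IsPGroup.exists_central_le_commutator {P : Type*} [Group P] [Finite P] {p : ℕ}
    (hp : p.Prime) (hP : IsPGroup p P) (hna : commutator P ≠ ⊥) :
    ∃ K : Subgroup P, K ≤ commutator P ∧ K ≤ Subgroup.center P ∧ Nat.card K = p := by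
  have : Fact p.Prime := ⟨hp⟩
  obtain ⟨z, hzc, hzZ, hz1⟩ := hP.exists_mem_inf_center hna
  have hdvd : p ∣ Nat.card (commutator P ⊓ Subgroup.center P : Subgroup P) := by
    refine ((hP.to_subgroup _).card_eq_or_dvd).resolve_left fun h => hz1 ?_
    rw [Subgroup.card_eq_one] at h
    rw [← Subgroup.mem_bot, ← h]
    exact ⟨hzc, hzZ⟩
  obtain ⟨⟨k, hk⟩, hkp⟩ := exists_prime_orderOf_dvd_card' p hdvd
  rw [Subgroup.orderOf_mk] at hkp
  exact ⟨Subgroup.zpowers k, (Subgroup.zpowers_le).2 hk.1, (Subgroup.zpowers_le).2 hk.2,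
    by rw [Nat.card_zpowers, hkp]⟩

theorem IsGCStarGroup.card_commutator_eq {p : ℕ} (hp : p.Prime) (n : ℕ) :
    ∀ (P : Type*) [Group P] [Finite P], Nat.card P = n → IsPGroup p P → IsGCStarGroup P →
      commutator P ≠ ⊥ → Nat.card (commutator P) = p := by
  induction n using Nat.strong_induction_on with
  | _ n ih =>
    intro P _ _ hn hP h hna
    obtain ⟨K, hKc, hKZ, hK⟩ := hP.exists_central_le_commutator hp hna
    have hKn : K.Normal := Subgroup.normal_of_le_center hKZ
    have hcard := QuotientGroup.card_commutator_mul_card hKc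
    by_cases hQ : commutator (P ⧸ K) = ⊥
    · rw [← hcard, hQ, Subgroup.card_bot, one_mul, hK]
    · exfalso
      have hlt : Nat.card (P ⧸ K) < n := by
        rw [← hn, Subgroup.card_eq_card_quotient_mul_card_subgroup K, hK]
        exact lt_mul_of_one_lt_right Nat.card_pos hp.one_lt
      have hQp := ih _ hlt (P ⧸ K) rfl (hP.to_quotient K)
        (h.of_surjective (QuotientGroup.mk'_surjective K)) hQ
      refine h.card_commutator_ne_sq hp hP hKc hKZ hK ?_
      rw [← hcard, hQp, hK, sq]

theorem theorem3p1 (p : ℕ) (hp : p.Prime) (P : Type*) [Group P] [Finite P]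
    (hP : IsPGroup p P) (hna : ¬ ∀ a b : P, a * b = b * a) :
    IsGCStarGroup P ↔
      IsCyclic (Subgroup.center P) ∧ Nat.card (commutator P) = p := by
  constructor
  · intro h
    have hbot : commutator P ≠ ⊥ := fun hb => hna fun a b =>
      commutatorElement_eq_one_iff_mul_comm.1
        ((Subgroup.mem_bot).1 (hb ▸ commutatorElement_mem_commutator a b))
    have hc := IsGCStarGroup.card_commutator_eq hp _ P rfl hP h hbot
    exact ⟨h.isCyclic_center hp hc (hP.le_center_of_card_prime hp hc), hc⟩
  · rintro ⟨hcyc, hc⟩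
    exact isGCStarGroup_of_isCyclic_center hp hP hc
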